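/- Let $\mathbb{O}$ be the algebra of octonions with standard basis $e_0=1,e_1,\dots,e_7$, where $e_ie_j=-\delta_{ij}+\sum_k\epsilon_{ijk}e_k$ for $i,j\ge1$ and $\epsilon$ is totally antisymmetric, equal to $1$ on the triples $(1,2,3),(1,4,5),(2,4,6),(3,4,7),(5,3,6),(6,1,7),(7,2,5)$ and $0$ off their permutations. Identify $\mathbb{O}$ with $\mathbb{R}^8$, and let $|\cdot|$ be the Euclidean norm. Fix $p\in\{0,1,\dots,6\}$, identify $\mathbb{R}^{p+1}$ with $\mathrm{span}_{\mathbb R}(e_0,\dots,e_p)$, and let $\mathbb{S}$ be the unit sphere of $\mathrm{span}_{\mathbb R}(e_{p+1},\dots,e_7)$. For $\Omega\subseteq\mathbb{O}$ and $\omega\in\mathbb{S}$ let $\Omega_\omega=\Omega\cap(\mathbb{R}^{p+1}\oplus\omega\mathbb{R})$, regarded as a subset of $\mathbb{R}^{p+2}$ through the coordinates $(x_0,\dots,x_p,r)\mapsto x_0e_0+\dots+x_pe_p+r\omega$. A domain is a nonempty connected open set. A domain $\Omega\subseteq\mathbb{O}$ is a slice domain if $\Omega\cap\mathbb{R}^{p+1}\neq\emptyset$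 and $\Omega_\omega$ is a domain in $\mathbb{R}^{p+2}$ for every $\omega\in\mathbb{S}$. A function $f:\Omega\to\mathbb{O}$ is (left) generalized partial-slice monogenic (of type $p$) if for every $\omega\in\mathbb{S}$ its restriction $f_\omega$ to $\Omega_\omega$ is of class $C^1$ and satisfies $$\sum_{i=0}^{p}e_i\,\frac{\partial f_\omega}{\partial x_i}+\omega\,\frac{\partial f_\omega}{\partial r}=0\quad\text{on }\Omega_\omega .$$ **Theorem (Maximum modulus principle).** Let $\Omega\subseteq\mathbb{O}$ be a slice domain and let $f:\Omega\to\mathbb{O}$ be a generalized partial-slice monogenic function. If $|f|$ has a relative maximum at some point of $\Omega$, then $f$ is constant on $\Omega$. -/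

import Mathlib

/-- The underlying real Euclidean space `ℝ⁸` of the octonions. The element
`(x₀, …, x₇)` stands for `x₀ + x₁ e₁ + ⋯ + x₇ e₇`; the modulus `|x|` is the Euclidean norm. -/
abbrev Octonion : Type := EuclideanSpace ℝ (Fin 8)

namespace Octonion

/-- The seven oriented triples `(a, b, c)` with `e_a e_b = e_c`. -/
def triples : List (Fin 8 × Fin 8 × Fin 8) :=
  [(1, 2, 3), (1, 4, 5), (2, 4, 6), (3, 4, 7), (5, 3, 6), (6, 1, 7), (7, 2, 5)]

/-- `ε_{ijk}`: the sign of the permutation if `(i, j, k)` is a permutation of one of the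
seven triples, and `0` otherwise. -/
def eps (i j k : Fin 8) : ℤ :=
  if (i, j, k) ∈ triples ∨ (j, k, i) ∈ triples ∨ (k, i, j) ∈ triples then 1
  else if (j, i, k) ∈ triples ∨ (i, k, j) ∈ triples ∨ (k, j, i) ∈ triples then -1
  else 0

/-- The coefficient of `e_k` in the product `e_i e_j`, where `e_0 = 1` is the unit and
`e_i e_j = -δ_{ij} + ∑ k, ε_{ijk} e_k` for `i, j ≥ 1`. -/
def structureConst (i j k : Fin 8) : ℤ :=
  if i = 0 then (if j = k then 1 else 0)
  else if j = 0 then (if i = k then 1 else 0)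
  else (if i = j ∧ k = 0 then -1 else 0) + eps i j k

/-- Octonionic multiplication: the bilinear extension of the multiplication of the basis. -/
noncomputable instance instMul : Mul Octonion where
  mul x y := WithLp.toLp 2 fun k =>
    ∑ i : Fin 8, ∑ j : Fin 8, (structureConst i j k : ℝ) * (x i * y j)

/-- The standard basis vector `e_i` of the octonions. -/
noncomputable def e (i : Fin 8) : Octonion := EuclideanSpace.single i 1

/-- The subspace `ℝ^{p+1}` of the octonions spanned by `e_0, …, e_p`. -/
def paravectors (p : Fin 7) : Set Octonion :=
  {x | ∀ i : Fin 8, (p : ℕ) < (i : ℕ) → x i = 0}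

/-- The unit sphere `𝕊` of the subspace spanned by `e_{p+1}, …, e_7`. -/
def sphere (p : Fin 7) : Set Octonion :=
  {ω | (∀ i : Fin 8, (i : ℕ) ≤ (p : ℕ) → ω i = 0) ∧ ‖ω‖ = 1}

/-- An index `i ∈ {0, …, p}`, seen as an index of a basis vector of the octonions. -/
def idx (p : Fin 7) (i : Fin ((p : ℕ) + 1)) : Fin 8 :=
  Fin.castLE (by omega) i

/-- The identification of `ℝ^{p+2}` with the slice `ℝ^{p+1} ⊕ ω ℝ`:
`(x₀, …, x_p, r) ↦ x₀ e_0 + ⋯ + x_p e_p + r ω`. -/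
noncomputable def slicePoint (p : Fin 7) (ω : Octonion)
    (v : EuclideanSpace ℝ (Fin ((p : ℕ) + 2))) : Octonion :=
  (∑ i : Fin ((p : ℕ) + 1), v i.castSucc • e (idx p i)) + v (Fin.last ((p : ℕ) + 1)) • ω

/-- The slice `Ω_ω = Ω ∩ (ℝ^{p+1} ⊕ ω ℝ)`, as a subset of `ℝ^{p+2}`. -/
def slice (p : Fin 7) (ω : Octonion) (Ω : Set Octonion) :
    Set (EuclideanSpace ℝ (Fin ((p : ℕ) + 2))) :=
  {v | slicePoint p ω v ∈ Ω}

/-- The restriction `f_ω` of `f` to a slice, as a function of `(x₀, …, x_p, r) ∈ ℝ^{p+2}`. -/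
noncomputable def restrict (p : Fin 7) (ω : Octonion) (f : Octonion → Octonion) :
    EuclideanSpace ℝ (Fin ((p : ℕ) + 2)) → Octonion :=
  fun v => f (slicePoint p ω v)

/-- The left slice Cauchy-Riemann operator
`D_ω F = ∑ i = 0, …, p, e_i (∂F/∂x_i) + ω (∂F/∂r)` for functions `F` on `ℝ^{p+2}`. -/
noncomputable def sliceD (p : Fin 7) (ω : Octonion)
    (F : EuclideanSpace ℝ (Fin ((p : ℕ) + 2)) → Octonion)
    (v : EuclideanSpace ℝ (Fin ((p : ℕ) + 2))) : Octonion :=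
  (∑ i : Fin ((p : ℕ) + 1),
      e (idx p i) * fderiv ℝ F v (EuclideanSpace.single i.castSucc 1)) +
    ω * fderiv ℝ F v (EuclideanSpace.single (Fin.last ((p : ℕ) + 1)) 1)

/-- `f` is (left) generalized partial-slice monogenic of type `p` on the open set `Ω`; only the
values of `f` on `Ω` matter. -/
def IsGSM (p : Fin 7) (Ω : Set Octonion) (f : Octonion → Octonion) : Prop :=
  ∀ ω ∈ sphere p,
    ContDiffOn ℝ 1 (restrict p ω f) (slice p ω Ω) ∧
      ∀ v ∈ slice p ω Ω, sliceD p ω (restrict p ω f) v = 0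

/-- `Ω` is a slice domain: a domain (nonempty connected open set) of the octonions that meets
`ℝ^{p+1}` and all of whose slices `Ω_ω` are domains in `ℝ^{p+2}`. -/
structure IsSliceDomain (p : Fin 7) (Ω : Set Octonion) : Prop where
  isOpen : IsOpen Ω
  isConnected : IsConnected Ω
  inter_nonempty : (Ω ∩ paravectors p).Nonempty
  slice_isOpen : ∀ ω ∈ sphere p, IsOpen (slice p ω Ω)
  slice_isConnected : ∀ ω ∈ sphere p, IsConnected (slice p ω Ω)

end Octonion

/-!
Left multiplication by the slice variable is norm-multiplicative, and polarising `‖a x‖ = ‖a‖ ‖x‖`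
is a substitute for associativity: summed against the rotation fields of the coordinate planes, it
expresses the antisymmetric part `⟪y·∇F, G⟫ - ⟪F, y·∇G⟫` of the Euler operator, for monogenic `F`
and `G`, through derivatives along rotations. Those integrate to zero against a radial weight `w`,
so the Euler operator is symmetric for the pairing `∫ w ⟪F, G⟫`, and the pairing
`B(s, t) = ∫ w(y) ⟪F(x + s y), F(x + t y)⟫` of the dilates of `F` depends on `s t` only.

The identity `B(0, r) = B(0, 0)` is a mean value property for `⟪F x, F⟫`; if `‖F x‖` is maximal, it
forces `F = F x` near `x`. The identity `B(q² r, r) = B(q r, q r)` yields unique continuation: if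
`F` vanishes on the ball of radius `q² r`, it vanishes on the ball of radius `q r`.

A monogenic function vanishing on a hyperplane has zero derivative there, so its extension by zero
from one side is monogenic, and unique continuation makes it vanish identically. All slices share
the paravectors, which form such a hyperplane in each of them; hence the constant value found on
the slice through the maximum propagates to every other slice.
-/

section CompositionSymbol

variable {E V W : Type*} [NormedAddCommGroup E] [InnerProductSpace ℝ E]
  [NormedAddCommGroup V] [InnerProductSpace ℝ V] [NormedAddCommGroup W] [InnerProductSpace ℝ W]
  {L : E →L[ℝ] V →L[ℝ] W}

/-- The bilinear map `(a, x) ↦ L a x` is a composition of quadratic forms. Multiplication in a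
real normed division algebra is the model, and `L` serves as the symbol of a first order
differential operator. -/
def IsComposition (L : E →L[ℝ] V →L[ℝ] W) : Prop :=
  ∀ a x, ‖L a x‖ = ‖a‖ * ‖x‖

lemma IsComposition.inner_apply_apply_self (hL : IsComposition L) (a b : E) (x : V) :
    inner ℝ (L a x) (L b x) = inner ℝ a b * ‖x‖ ^ 2 := by
  have h : ‖L a x + L b x‖ ^ 2 = ‖a + b‖ ^ 2 * ‖x‖ ^ 2 := by
    rw [← mul_pow, ← hL, map_add, add_apply]
  rw [norm_add_sq_real, norm_add_sq_real, hL, hL] at h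
  linarith

lemma IsComposition.inner_apply_add_inner_apply (hL : IsComposition L) (a b : E) (x y : V) :
    inner ℝ (L a x) (L b y) + inner ℝ (L b x) (L a y) = 2 * inner ℝ a b * inner ℝ x y := by
  have h := hL.inner_apply_apply_self a b (x + y)
  simp only [map_add, inner_add_left, inner_add_right, hL.inner_apply_apply_self,
    norm_add_sq_real] at h
  rw [real_inner_comm (L a y) (L b x)]
  linarith

/-- The generator of the rotations in the oriented plane of `u` and `v`. -/
def rotationField (u v y : E) : E :=
  inner ℝ v y • u - inner ℝ u y • v

lemma rotationField_swap (u v y : E) : rotationField v u y = -rotationField u v y := by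
  simp [rotationField]

variable {ι : Type*} [Fintype ι] {b : OrthonormalBasis ι ℝ E} {A : E →L[ℝ] V}

lemma IsComposition.sum_inner_apply_rotationField (hL : IsComposition L)
    (hA : ∑ i, L (b i) (A (b i)) = 0) (y : E) (z : V) :
    ∑ i, ∑ j, inner ℝ (L (b j) (A (rotationField (b i) (b j) y))) (L (b i) z)
      = 2 * inner ℝ (A y) z := by
  have hswap (i j : ι) : inner ℝ (L (b j) (A (rotationField (b i) (b j) y))) (L (b i) z)
      = 2 * inner ℝ (b i) (b j) * (inner ℝ (b j) y * inner ℝ (A (b i)) z)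
        - inner ℝ (L (b i) (A (b i))) (inner ℝ (b j) y • L (b j) z)
        - inner ℝ (L (b j) (A (b j))) (inner ℝ (b i) y • L (b i) z) := by
    have h := hL.inner_apply_add_inner_apply (b i) (b j) (A (b i)) z
    simp only [rotationField, map_sub, map_smul, inner_sub_left, inner_smul_left,
      inner_smul_right, conj_trivial]
    linear_combination inner ℝ (b j) y * h
  have hAy : ∑ i, inner ℝ (b i) y * inner ℝ (A (b i)) z = inner ℝ (A y) z := by
    conv_rhs => rw [← b.sum_repr' y, map_sum, sum_inner]
    simp [inner_smul_left]
  classical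
  simp only [hswap, Finset.sum_sub_distrib, ← inner_sum, ← sum_inner,
    orthonormal_iff_ite.1 b.orthonormal, hA, inner_zero_left, sub_zero, mul_ite, ite_mul, mul_one,
    mul_zero, zero_mul, Finset.sum_ite_eq, Finset.mem_univ, if_true]
  rw [← hAy, Finset.mul_sum]

end CompositionSymbol

section RadialBump

open Metric

variable {E : Type*} [NormedAddCommGroup E]

/-- A radial bump function, positive exactly on the open unit ball. -/
noncomputable def radialBump (y : E) : ℝ :=
  Real.smoothTransition (1 - ‖y‖ ^ 2)

lemma radialBump_nonneg (y : E) : 0 ≤ radialBump y :=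
  Real.smoothTransition.nonneg _

lemma radialBump_pos {y : E} (hy : y ∈ ball 0 1) : 0 < radialBump y := by
  rw [mem_ball_zero_iff] at hy
  exact Real.smoothTransition.pos_of_pos (by nlinarith [norm_nonneg y])

lemma radialBump_eq_zero {y : E} (hy : y ∉ ball 0 1) : radialBump y = 0 := by
  rw [mem_ball_zero_iff, not_lt] at hy
  exact Real.smoothTransition.zero_of_nonpos (by nlinarith)

lemma hasCompactSupport_radialBump [ProperSpace E] : HasCompactSupport (radialBump : E → ℝ) :=
  .intro (isCompact_closedBall 0 1) fun _ hy =>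
    radialBump_eq_zero fun hy' => hy (ball_subset_closedBall hy')

variable [InnerProductSpace ℝ E]

lemma contDiff_radialBump {n : ℕ∞} : ContDiff ℝ n (radialBump : E → ℝ) :=
  Real.smoothTransition.contDiff.comp (contDiff_const.sub (contDiff_norm_sq ℝ))

lemma continuous_radialBump : Continuous (radialBump : E → ℝ) :=
  (contDiff_radialBump (n := 0)).continuous

lemma fderiv_radialBump_rotationField (u v y : E) :
    fderiv ℝ radialBump y (rotationField u v y) = 0 := by
  have h : HasFDerivAt (fun y : E => 1 - ‖y‖ ^ 2) _ y :=
    (hasStrictFDerivAt_norm_sq y).hasFDerivAt.const_sub 1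
  have hφ : DifferentiableAt ℝ Real.smoothTransition (1 - ‖y‖ ^ 2) :=
    (Real.smoothTransition.contDiff (n := 1)).differentiable one_ne_zero _
  have : HasFDerivAt (radialBump : E → ℝ) _ y := hφ.hasDerivAt.comp_hasFDerivAt y h
  rw [this.fderiv]
  simp [rotationField, inner_sub_right, inner_smul_right, real_inner_comm, mul_comm]

end RadialBump

section Integration

open MeasureTheory

lemma integral_mul_fderiv_eq_neg_of_hasCompactSupport {E : Type*} [NormedAddCommGroup E]
    [NormedSpace ℝ E] [FiniteDimensional ℝ E] [MeasurableSpace E] [BorelSpace E] {μ : Measure E}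
    [μ.IsAddHaarMeasure] {g H : E → ℝ} (hg : ContDiff ℝ 1 g) (hgs : HasCompactSupport g)
    (hH : ContDiff ℝ 1 H) (u : E) :
    ∫ y, g y * fderiv ℝ H y u ∂μ = -∫ y, fderiv ℝ g y u * H y ∂μ := by
  refine integral_mul_fderiv_eq_neg_fderiv_mul_of_integrable ?_ ?_ ?_
    (fun y _ => hg.differentiable one_ne_zero y) fun y _ => hH.differentiable one_ne_zero y
  · exact (((hg.continuous_fderiv one_ne_zero).clm_apply continuous_const).mul
      hH.continuous).integrable_of_hasCompactSupport (hgs.fderiv_apply ℝ u).mul_right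
  · exact (hg.continuous.mul ((hH.continuous_fderiv one_ne_zero).clm_apply
      continuous_const)).integrable_of_hasCompactSupport hgs.mul_right
  · exact (hg.continuous.mul hH.continuous).integrable_of_hasCompactSupport hgs.mul_right

variable {E : Type*} [NormedAddCommGroup E] [InnerProductSpace ℝ E] [FiniteDimensional ℝ E]
  [MeasurableSpace E] [BorelSpace E]

lemma integrable_radialBump_mul {g : E → ℝ} (hg : Continuous g) :
    Integrable fun y : E => radialBump y * g y :=
  (continuous_radialBump.mul hg).integrable_of_hasCompactSupport
    hasCompactSupport_radialBump.mul_right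

lemma integral_radialBump_mul_fderiv_rotationField {H : E → ℝ} (hH : ContDiff ℝ 1 H) (u v : E) :
    ∫ y, radialBump y * fderiv ℝ H y (rotationField u v y) = 0 := by
  let g (v y : E) : ℝ := radialBump y * inner ℝ v y
  have hg (v) : ContDiff ℝ 1 (g v) := contDiff_radialBump.mul (contDiff_const.inner ℝ contDiff_id)
  have hgs (v) : HasCompactSupport (g v) := hasCompactSupport_radialBump.mul_right
  have hDg (u v y : E) : fderiv ℝ (g v) y u
      = radialBump y * inner ℝ v u + inner ℝ v y * fderiv ℝ radialBump y u := by
    have hw := ((contDiff_radialBump (n := 1)).differentiable one_ne_zero y).hasFDerivAt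
    have : HasFDerivAt (g v) _ y := hw.mul (innerSL ℝ v).hasFDerivAt
    rw [this.fderiv]
    rfl
  have hsymm (y : E) : fderiv ℝ (g v) y u = fderiv ℝ (g u) y v := by
    have h := fderiv_radialBump_rotationField u v y
    simp only [rotationField, map_sub, map_smul, smul_eq_mul] at h
    rw [hDg, hDg, real_inner_comm]
    linear_combination h
  have hint (u v : E) : Integrable fun y => g v y * fderiv ℝ H y u := by
    simp only [g, mul_assoc]
    exact integrable_radialBump_mul ((continuous_const.inner continuous_id).mul
      ((hH.continuous_fderiv one_ne_zero).clm_apply continuous_const))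
  calc ∫ y, radialBump y * fderiv ℝ H y (rotationField u v y)
      = ∫ y, (g v y * fderiv ℝ H y u - g u y * fderiv ℝ H y v) := by
        simp only [rotationField, map_sub, map_smul, smul_eq_mul, g, mul_sub, mul_assoc]
    _ = (-∫ y, fderiv ℝ (g v) y u * H y) - -∫ y, fderiv ℝ (g u) y v * H y := by
        rw [integral_sub (hint u v) (hint v u),
          integral_mul_fderiv_eq_neg_of_hasCompactSupport (hg v) (hgs v) hH,
          integral_mul_fderiv_eq_neg_of_hasCompactSupport (hg u) (hgs u) hH]
    _ = 0 := by simp only [hsymm, sub_self]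

end Integration

section Monogenic

variable {ι E V W : Type*} [Fintype ι] [NormedAddCommGroup E] [InnerProductSpace ℝ E]
  [NormedAddCommGroup V] [InnerProductSpace ℝ V] [NormedAddCommGroup W] [InnerProductSpace ℝ W]
  {b : OrthonormalBasis ι ℝ E} {L : E →L[ℝ] V →L[ℝ] W} {F G : E → V} {U U' : Set E} {x : E}

/-- The first order operator `∑ i, L (b i) ∂ᵢ` with symbol `L`, written in the orthonormal
basis `b`; the generalized Cauchy–Riemann operators have this form. -/
noncomputable def dirac (b : OrthonormalBasis ι ℝ E) (L : E →L[ℝ] V →L[ℝ] W) (F : E → V)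
    (x : E) : W :=
  ∑ i, L (b i) (fderiv ℝ F x (b i))

/-- `F` is monogenic on `U`: a `C¹` solution of the equation `dirac b L F = 0` there. -/
structure IsMonogenicOn (b : OrthonormalBasis ι ℝ E) (L : E →L[ℝ] V →L[ℝ] W) (F : E → V)
    (U : Set E) : Prop where
  contDiffOn : ContDiffOn ℝ 1 F U
  dirac_eq_zero : ∀ x ∈ U, dirac b L F x = 0

lemma dirac_congr (h : F =ᶠ[nhds x] G) : dirac b L F x = dirac b L G x := by
  simp only [dirac, h.fderiv_eq]

lemma IsMonogenicOn.mono (hF : IsMonogenicOn b L F U) (h : U' ⊆ U) : IsMonogenicOn b L F U' :=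
  ⟨hF.contDiffOn.mono h, fun x hx => hF.dirac_eq_zero x (h hx)⟩

lemma IsMonogenicOn.sub_const (hF : IsMonogenicOn b L F U) (c : V) :
    IsMonogenicOn b L (fun x => F x - c) U :=
  ⟨hF.contDiffOn.sub contDiffOn_const, fun x hx => by
    simpa only [dirac, fderiv_sub_const] using hF.dirac_eq_zero x hx⟩

lemma fderiv_comp_add_smul (F : E → V) (x y : E) (s : ℝ) :
    fderiv ℝ (fun y => F (x + s • y)) y = s • fderiv ℝ F (x + s • y) := by
  rw [fderiv_comp_smul (f := fun z => F (x + z)), fderiv_comp_add_left]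

lemma hasDerivAt_comp_add_smul {s : ℝ → ℝ} {s' τ : ℝ} (hF : Differentiable ℝ F)
    (hs : HasDerivAt s s' τ) (x y : E) :
    HasDerivAt (fun τ => F (x + s τ • y)) (s' • fderiv ℝ F (x + s τ • y) y) τ := by
  have h : HasDerivAt (fun τ => x + s τ • y) (s' • y) τ := (hs.smul_const y).const_add x
  simpa [Function.comp_def] using (hF _).hasFDerivAt.comp_hasDerivAt τ h

lemma dirac_comp_add_smul (F : E → V) (x y : E) (s : ℝ) :
    dirac b L (fun y => F (x + s • y)) y = s • dirac b L F (x + s • y) := by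
  simp [dirac, fderiv_comp_add_smul, Finset.smul_sum]

end Monogenic

section Symmetry

open MeasureTheory Metric

variable {ι E V W : Type*} [Fintype ι] [NormedAddCommGroup E] [InnerProductSpace ℝ E]
  [NormedAddCommGroup V] [InnerProductSpace ℝ V] [NormedAddCommGroup W] [InnerProductSpace ℝ W]
  {b : OrthonormalBasis ι ℝ E} {L : E →L[ℝ] V →L[ℝ] W} {F G : E → V}

lemma IsComposition.sum_fderiv_inner_rotationField (hL : IsComposition L)
    (hF : Differentiable ℝ F) (hG : Differentiable ℝ G) {y : E} (hF0 : dirac b L F y = 0)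
    (hG0 : dirac b L G y = 0) :
    ∑ i, ∑ j, fderiv ℝ (fun z => (inner ℝ (L (b j) (F z)) (L (b i) (G z)) : ℝ)) y
        (rotationField (b i) (b j) y)
      = 2 * (inner ℝ (fderiv ℝ F y y) (G y) - inner ℝ (F y) (fderiv ℝ G y y)) := by
  have hD (i j : ι) (v : E) :
      fderiv ℝ (fun z => (inner ℝ (L (b j) (F z)) (L (b i) (G z)) : ℝ)) y v
        = inner ℝ (L (b j) (fderiv ℝ F y v)) (L (b i) (G y))
          + inner ℝ (L (b i) (fderiv ℝ G y v)) (L (b j) (F y)) := by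
    have hF' : HasFDerivAt (fun z => L (b j) (F z)) _ y :=
      (L (b j)).hasFDerivAt.comp y (hF y).hasFDerivAt
    have hG' : HasFDerivAt (fun z => L (b i) (G z)) _ y :=
      (L (b i)).hasFDerivAt.comp y (hG y).hasFDerivAt
    rw [fderiv_inner_apply ℝ hF'.differentiableAt hG'.differentiableAt, hF'.fderiv, hG'.fderiv,
      add_comm, real_inner_comm (L (b j) (F y))]
    rfl
  have hGsum : ∑ i, ∑ j, inner ℝ (L (b i) (fderiv ℝ G y (rotationField (b i) (b j) y)))
      (L (b j) (F y)) = -(2 * inner ℝ (fderiv ℝ G y y) (F y)) := by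
    rw [← hL.sum_inner_apply_rotationField hG0, Finset.sum_comm]
    simp only [← Finset.sum_neg_distrib]
    refine Finset.sum_congr rfl fun i _ => Finset.sum_congr rfl fun j _ => ?_
    rw [rotationField_swap, map_neg, map_neg, inner_neg_left]
  simp only [hD, Finset.sum_add_distrib, hL.sum_inner_apply_rotationField hF0, hGsum]
  rw [real_inner_comm (F y)]
  ring

variable [FiniteDimensional ℝ E] [MeasurableSpace E] [BorelSpace E]

lemma IsComposition.integral_inner_fderiv_symm (hL : IsComposition L)
    (hF : ContDiff ℝ 1 F) (hG : ContDiff ℝ 1 G) (hF0 : ∀ y ∈ ball 0 1, dirac b L F y = 0)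
    (hG0 : ∀ y ∈ ball 0 1, dirac b L G y = 0) :
    ∫ y, radialBump y * (inner ℝ (fderiv ℝ F y y) (G y) - inner ℝ (F y) (fderiv ℝ G y y)) = 0 := by
  let H (i j : ι) (y : E) : ℝ := inner ℝ (L (b j) (F y)) (L (b i) (G y))
  have hH (i j) : ContDiff ℝ 1 (H i j) :=
    ((L (b j)).contDiff.comp hF).inner ℝ ((L (b i)).contDiff.comp hG)
  have hpoint (y : E) :
      2 * (radialBump y * (inner ℝ (fderiv ℝ F y y) (G y) - inner ℝ (F y) (fderiv ℝ G y y)))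
        = ∑ i, ∑ j, radialBump y * fderiv ℝ (H i j) y (rotationField (b i) (b j) y) := by
    by_cases hy : y ∈ ball (0 : E) 1
    · simp only [← Finset.mul_sum, H, hL.sum_fderiv_inner_rotationField
        (hF.differentiable one_ne_zero) (hG.differentiable one_ne_zero) (hF0 y hy) (hG0 y hy)]
      ring
    · simp [radialBump_eq_zero hy]
  have hint (i j : ι) :
      Integrable fun y => radialBump y * fderiv ℝ (H i j) y (rotationField (b i) (b j) y) := by
    refine integrable_radialBump_mul (((hH i j).continuous_fderiv one_ne_zero).clm_apply ?_)
    unfold rotationField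
    fun_prop
  refine (mul_eq_zero_iff_left (two_ne_zero (α := ℝ))).1 ?_
  rw [← integral_const_mul]
  simp only [hpoint]
  rw [integral_finsetSum _ fun i _ => integrable_finsetSum _ fun j _ => hint i j]
  refine Finset.sum_eq_zero fun i _ => ?_
  rw [integral_finsetSum _ fun j _ => hint i j]
  exact Finset.sum_eq_zero fun j _ => integral_radialBump_mul_fderiv_rotationField (hH i j) _ _

end Symmetry

section DilationPairing

open MeasureTheory Metric Set Filter Topology

lemma hasDerivAt_integral_mul_of_hasCompactSupport {X : Type*} [TopologicalSpace X]
    [MeasurableSpace X] [OpensMeasurableSpace X] {μ : Measure X} [IsFiniteMeasureOnCompacts μ]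
    {w : X → ℝ} (hw : Continuous w) (hws : HasCompactSupport w) {K K' : ℝ → X → ℝ}
    (hK : ∀ t, Continuous (K t)) (hK' : Continuous (Function.uncurry K'))
    (hKK' : ∀ t y, HasDerivAt (K · y) (K' t y) t) (t : ℝ) :
    HasDerivAt (fun t => ∫ y, w y * K t y ∂μ) (∫ y, w y * K' t y ∂μ) t := by
  have hint {g : X → ℝ} (hg : Continuous g) : Integrable (fun y => w y * g y) μ :=
    (hw.mul hg).integrable_of_hasCompactSupport hws.mul_right
  obtain ⟨C, hC⟩ := ((isCompact_closedBall t 1).prod hws).exists_bound_of_continuousOn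
    hK'.continuousOn
  refine (hasDerivAt_integral_of_dominated_loc_of_deriv_le (closedBall_mem_nhds t one_pos)
    (bound := fun y => ‖w y * C‖) (.of_forall fun s => (hint (hK s)).aestronglyMeasurable)
    (hint (hK t)) (hint (hK'.comp (.prodMk_right t))).aestronglyMeasurable
    (.of_forall fun y s hs => ?_) (hint continuous_const).norm
    (.of_forall fun y s _ => (hKK' s y).const_mul (w y))).2
  by_cases hy : y ∈ tsupport w
  · rw [norm_mul, norm_mul]
    gcongr
    exact (hC (s, y) ⟨hs, hy⟩).trans (le_abs_self C)
  · simp [image_eq_zero_of_notMem_tsupport hy]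

variable {ι E V W : Type*} [Fintype ι] [NormedAddCommGroup E] [InnerProductSpace ℝ E]
  [FiniteDimensional ℝ E] [MeasurableSpace E] [BorelSpace E]
  [NormedAddCommGroup V] [InnerProductSpace ℝ V] [NormedAddCommGroup W] [InnerProductSpace ℝ W]
  {b : OrthonormalBasis ι ℝ E} {L : E →L[ℝ] V →L[ℝ] W} {F : E → V} {x : E} {r : ℝ}

/-- The `L²` pairing, against the radial bump on the unit ball, of the dilates of `F` by the
factors `s` and `t` about `x`. -/
noncomputable def dilationPairing (F : E → V) (x : E) (s t : ℝ) : ℝ :=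
  ∫ y, radialBump y * inner ℝ (F (x + s • y)) (F (x + t • y))

lemma continuous_dilationPairing (hF : Continuous F) {s t : ℝ → ℝ} (hs : Continuous s)
    (ht : Continuous t) : Continuous fun τ => dilationPairing F x (s τ) (t τ) := by
  rw [← continuousOn_univ]
  refine continuousOn_integral_of_compact_support (isCompact_closedBall 0 1) ?_
    fun τ y _ hy => by
      rw [radialBump_eq_zero fun hy' => hy (ball_subset_closedBall hy'), zero_mul]
  have := continuous_radialBump (E := E)
  unfold Function.uncurry
  fun_prop

lemma hasDerivAt_dilationPairing (hF : ContDiff ℝ 1 F) {s s' t t' : ℝ → ℝ}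
    (hs : ∀ τ, HasDerivAt s (s' τ) τ) (hs' : Continuous s')
    (ht : ∀ τ, HasDerivAt t (t' τ) τ) (ht' : Continuous t') (τ : ℝ) :
    HasDerivAt (fun τ => dilationPairing F x (s τ) (t τ))
      (∫ y, radialBump y *
        (inner ℝ (F (x + s τ • y)) (t' τ • fderiv ℝ F (x + t τ • y) y)
          + inner ℝ (s' τ • fderiv ℝ F (x + s τ • y) y) (F (x + t τ • y)))) τ := by
  have hsc : Continuous s := continuous_iff_continuousAt.2 fun τ => (hs τ).continuousAt
  have htc : Continuous t := continuous_iff_continuousAt.2 fun τ => (ht τ).continuousAt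
  have hFd := hF.differentiable one_ne_zero
  exact hasDerivAt_integral_mul_of_hasCompactSupport continuous_radialBump
    hasCompactSupport_radialBump (by fun_prop) (by unfold Function.uncurry; fun_prop)
    (fun τ y => (hasDerivAt_comp_add_smul hFd (hs τ) x y).inner ℝ
      (hasDerivAt_comp_add_smul hFd (ht τ) x y)) τ

lemma IsComposition.integral_inner_smul_fderiv_symm (hL : IsComposition L) (hF : ContDiff ℝ 1 F)
    (hF0 : ∀ y ∈ ball x r, dirac b L F y = 0) {s t : ℝ} (hs : s ∈ Icc 0 r) (ht : t ∈ Icc 0 r) :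
    ∫ y, radialBump y * (inner ℝ (s • fderiv ℝ F (x + s • y) y) (F (x + t • y))
      - inner ℝ (F (x + s • y)) (t • fderiv ℝ F (x + t • y) y)) = 0 := by
  have hdilate (s : ℝ) : ContDiff ℝ 1 fun y => F (x + s • y) := hF.comp (by fun_prop)
  have hdirac {s : ℝ} (hs : s ∈ Icc 0 r) (y : E) (hy : y ∈ ball 0 1) :
      dirac b L (fun y => F (x + s • y)) y = 0 := by
    rw [dirac_comp_add_smul]
    rcases hs.1.eq_or_lt with rfl | hs0
    · rw [zero_smul]
    · rw [hF0, smul_zero]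
      rw [mem_ball_zero_iff] at hy
      rw [mem_ball, dist_self_add_left, norm_smul, Real.norm_of_nonneg hs.1]
      nlinarith [hs.2]
  simpa only [fderiv_comp_add_smul, smul_apply] using
    hL.integral_inner_fderiv_symm (hdilate s) (hdilate t) (hdirac hs) (hdirac ht)

lemma IsComposition.dilationPairing_exp (hL : IsComposition L) (hF : ContDiff ℝ 1 F)
    (hF0 : ∀ y ∈ ball x r, dirac b L F y = 0) {a τ : ℝ} (ha : 0 ≤ a) (hτ : 0 ≤ τ)
    (hr : Real.exp τ * a ≤ r) :
    dilationPairing F x (Real.exp (-τ) * a) (Real.exp τ * a) = dilationPairing F x a a := by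
  have hderiv := hasDerivAt_dilationPairing (x := x) hF
    (s := fun τ => Real.exp (-τ) * a) (s' := fun τ => -(Real.exp (-τ) * a))
    (fun τ => by simpa using (hasDerivAt_neg τ).exp.mul_const a) (by fun_prop)
    (fun τ => (Real.hasDerivAt_exp τ).mul_const a) (by fun_prop)
  have hzero (σ : ℝ) (hσ : σ ∈ Ico 0 τ) := by
    have hle : Real.exp (-σ) * a ≤ Real.exp σ * a := by
      gcongr
      linarith [hσ.1]
    have ht : Real.exp σ * a ∈ Icc 0 r :=
      ⟨by positivity, le_trans (by gcongr; exact hσ.2.le) hr⟩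
    exact hL.integral_inner_smul_fderiv_symm hF hF0 ⟨by positivity, hle.trans ht.2⟩ ht
  have h := constant_of_has_deriv_right_zero (a := 0) (b := τ)
    (fun σ _ => (hderiv σ).continuousAt.continuousWithinAt) (fun σ hσ => ?_) τ ⟨hτ, le_rfl⟩
  · simpa using h
  · convert (hderiv σ).hasDerivWithinAt using 1
    rw [← neg_zero, ← hzero σ hσ, ← integral_neg]
    congr with y
    rw [neg_smul, inner_neg_left]
    ring

lemma IsComposition.dilationPairing_sq_mul (hL : IsComposition L) (hF : ContDiff ℝ 1 F)
    (hF0 : ∀ y ∈ ball x r, dirac b L F y = 0) (hr : 0 ≤ r) {q : ℝ} (hq : q ∈ Ioc 0 1) :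
    dilationPairing F x (q ^ 2 * r) r = dilationPairing F x (q * r) (q * r) := by
  have h := hL.dilationPairing_exp hF hF0 (mul_nonneg hq.1.le hr)
    (neg_nonneg.2 (Real.log_nonpos hq.1.le hq.2))
  rw [neg_neg, Real.exp_neg, Real.exp_log hq.1, inv_mul_cancel_left₀ hq.1.ne', ← mul_assoc,
    ← sq] at h
  exact h le_rfl

lemma IsComposition.dilationPairing_zero_left (hL : IsComposition L) (hF : ContDiff ℝ 1 F)
    (hF0 : ∀ y ∈ ball x r, dirac b L F y = 0) (hr : 0 ≤ r) :
    dilationPairing F x 0 r = dilationPairing F x 0 0 := by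
  have hlim {s t : ℝ → ℝ} (hs : Continuous s) (ht : Continuous t) :
      Tendsto (fun q => dilationPairing F x (s q) (t q)) (𝓝[>] 0)
        (𝓝 (dilationPairing F x (s 0) (t 0))) :=
    ((continuous_dilationPairing hF.continuous hs ht).tendsto 0).mono_left nhdsWithin_le_nhds
  have heq : (fun q : ℝ => dilationPairing F x (q ^ 2 * r) r)
      =ᶠ[𝓝[>] 0] fun q => dilationPairing F x (q * r) (q * r) := by
    filter_upwards [Ioc_mem_nhdsGT one_pos] with q hq
    exact hL.dilationPairing_sq_mul hF hF0 hr hq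
  have h := tendsto_nhds_unique_of_eventuallyEq (hlim (by fun_prop) (by fun_prop))
    (hlim (by fun_prop) (by fun_prop)) heq
  simpa using h

end DilationPairing

section MaximumPrinciple

open MeasureTheory Metric Set Topology

lemma eq_zero_of_integral_radialBump_mul_nonpos {E : Type*} [NormedAddCommGroup E]
    [InnerProductSpace ℝ E] [FiniteDimensional ℝ E] [MeasurableSpace E] [BorelSpace E]
    {g : E → ℝ} (hg : Continuous g) (hg0 : ∀ y ∈ ball 0 1, 0 ≤ g y)
    (hint : ∫ y, radialBump y * g y ≤ 0) : ∀ y ∈ ball 0 1, g y = 0 := by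
  intro y hy
  by_contra hne
  have hwg := continuous_radialBump.mul hg
  refine hint.not_gt (hwg.integral_pos_of_hasCompactSupport_nonneg_nonzero
    hasCompactSupport_radialBump.mul_right (fun z => ?_) (x := y) ?_)
  · by_cases hz : z ∈ ball (0 : E) 1
    · exact mul_nonneg (radialBump_nonneg z) (hg0 z hz)
    · simp [radialBump_eq_zero hz]
  · exact mul_ne_zero (radialBump_pos hy).ne' hne

lemma exists_contDiff_eqOn_ball {E V : Type*} [NormedAddCommGroup E] [NormedSpace ℝ E]
    [HasContDiffBump E] [NormedAddCommGroup V] [NormedSpace ℝ V]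
    {F : E → V} {x : E} {r R : ℝ} (hF : ContDiffOn ℝ 1 F (ball x R)) (hr : 0 < r) (hrR : r < R) :
    ∃ G : E → V, ContDiff ℝ 1 G ∧ EqOn G F (ball x r) := by
  obtain ⟨r', hr', hr'R⟩ := exists_between hrR
  let η : ContDiffBump x := ⟨r, r', hr, hr'⟩
  refine ⟨fun y => η y • F y, contDiff_iff_contDiffAt.2 fun y => ?_, fun y hy => ?_⟩
  · by_cases hy : y ∈ ball x R
    · exact η.contDiffAt.smul (hF.contDiffAt (isOpen_ball.mem_nhds hy))
    · have hy' : y ∉ tsupport η := by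
        rw [η.tsupport_eq]
        exact fun h => hy (closedBall_subset_ball hr'R h)
      refine (contDiffAt_const (c := (0 : V))).congr_of_eventuallyEq ?_
      filter_upwards [notMem_tsupport_iff_eventuallyEq.1 hy'] with z hz
      rw [hz, Pi.zero_apply, zero_smul]
  · simp [η.one_of_mem_closedBall (ball_subset_closedBall hy)]

lemma forall_mem_ball_iff_add_smul {E : Type*} [NormedAddCommGroup E] [NormedSpace ℝ E] {x : E}
    {r : ℝ} (hr : 0 < r) {P : E → Prop} :
    (∀ z ∈ ball x r, P z) ↔ ∀ y ∈ ball 0 1, P (x + r • y) := by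
  rw [← affinity_unitBall hr x, ← image_vadd, ← image_smul, image_image, forall_mem_image]
  rfl

variable {ι E V W : Type*} [Fintype ι] [NormedAddCommGroup E] [InnerProductSpace ℝ E]
  [NormedAddCommGroup V] [InnerProductSpace ℝ V] [NormedAddCommGroup W] [InnerProductSpace ℝ W]
  {b : OrthonormalBasis ι ℝ E} {L : E →L[ℝ] V →L[ℝ] W} {F : E → V} {U : Set E} {x : E} {r R : ℝ}

lemma IsComposition.eqOn_ball_of_forall_norm_le (hL : IsComposition L) (hF : ContDiff ℝ 1 F)
    (hF0 : ∀ y ∈ ball x r, dirac b L F y = 0) (hr : 0 < r)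
    (hmax : ∀ y ∈ ball x r, ‖F y‖ ≤ ‖F x‖) : ∀ y ∈ ball x r, F y = F x := by
  have := b.toBasis.finiteDimensional_of_finite
  borelize E
  have hc := hF.continuous
  rw [forall_mem_ball_iff_add_smul hr] at hmax ⊢
  -- Since `‖F‖ ≤ ‖F x‖`, the function `⟪F x, F x - F⟫` dominates `‖F - F x‖ ^ 2 / 2`.
  have hle (y : E) (hy : y ∈ ball 0 1) : ‖F (x + r • y) - F x‖ ^ 2
      ≤ 2 * (inner ℝ (F x) (F x) - inner ℝ (F x) (F (x + r • y))) := by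
    have h := pow_le_pow_left₀ (norm_nonneg _) (hmax y hy) 2
    rw [norm_sub_sq_real, real_inner_self_eq_norm_sq, real_inner_comm]
    linarith
  have hmean : ∫ y, radialBump y * (inner ℝ (F x) (F x) - inner ℝ (F x) (F (x + r • y))) = 0 := by
    have h := hL.dilationPairing_zero_left hF hF0 hr.le
    simp only [dilationPairing, zero_smul, add_zero] at h
    simp only [mul_sub]
    rw [integral_sub (integrable_radialBump_mul (by fun_prop))
      (integrable_radialBump_mul (by fun_prop)), h, sub_self]
  have hzero := eq_zero_of_integral_radialBump_mul_nonpos (by fun_prop)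
    (fun y hy => by linarith [hle y hy, sq_nonneg ‖F (x + r • y) - F x‖]) hmean.le
  intro y hy
  rw [← sub_eq_zero, ← norm_eq_zero, ← sq_nonpos_iff]
  linarith [hle y hy, hzero y hy]

lemma IsComposition.eqOn_ball_zero_of_eqOn_ball_sq_mul (hL : IsComposition L)
    (hF : ContDiff ℝ 1 F) (hF0 : ∀ y ∈ ball x r, dirac b L F y = 0) (hr : 0 < r) {q : ℝ}
    (hq : q ∈ Ioc 0 1) (hzero : ∀ y ∈ ball x (q ^ 2 * r), F y = 0) :
    ∀ y ∈ ball x (q * r), F y = 0 := by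
  have := b.toBasis.finiteDimensional_of_finite
  borelize E
  have hc := hF.continuous
  have hq0 : 0 < q := hq.1
  rw [forall_mem_ball_iff_add_smul (by positivity)] at hzero ⊢
  have hpair : dilationPairing F x (q ^ 2 * r) r = 0 := by
    refine integral_eq_zero_of_ae (.of_forall fun y => ?_)
    by_cases hy : y ∈ ball (0 : E) 1
    · simp [hzero y hy]
    · simp [radialBump_eq_zero hy]
  rw [hL.dilationPairing_sq_mul hF hF0 hr.le hq] at hpair
  have h := eq_zero_of_integral_radialBump_mul_nonpos (by fun_prop)
    (fun y _ => real_inner_self_nonneg) hpair.le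
  exact fun y hy => inner_self_eq_zero.1 (h y hy)

lemma IsMonogenicOn.exists_contDiff_dirac_eq_zero (hF : IsMonogenicOn b L F (ball x R)) (hr : 0 < r)
    (hrR : r < R) :
    ∃ G : E → V, ContDiff ℝ 1 G ∧ EqOn G F (ball x r) ∧ ∀ y ∈ ball x r, dirac b L G y = 0 := by
  obtain ⟨G, hG, hGF⟩ := exists_contDiff_eqOn_ball hF.contDiffOn hr hrR
  refine ⟨G, hG, hGF, fun y hy => ?_⟩
  rw [dirac_congr (hGF.eventuallyEq_of_mem (isOpen_ball.mem_nhds hy))]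
  exact hF.dirac_eq_zero y (ball_subset_ball hrR.le hy)

theorem IsMonogenicOn.eventually_eq_of_isLocalMax_norm (hF : IsMonogenicOn b L F U)
    (hL : IsComposition L) (hU : U ∈ 𝓝 x) (hmax : IsLocalMax (fun y => ‖F y‖) x) :
    ∀ᶠ y in 𝓝 x, F y = F x := by
  obtain ⟨R, hR, hball⟩ := eventually_nhds_iff_ball.1 (hmax.and hU)
  obtain ⟨r, hr, hrR⟩ := exists_between hR
  obtain ⟨G, hG, hGF, hG0⟩ :=
    (hF.mono fun y hy => (hball y hy).2).exists_contDiff_dirac_eq_zero hr hrR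
  have hGx : G x = F x := hGF (mem_ball_self hr)
  have hconst := hL.eqOn_ball_of_forall_norm_le hG hG0 hr fun y hy => by
    rw [hGF hy, hGx]
    exact (hball y (ball_subset_ball hrR.le hy)).1
  filter_upwards [ball_mem_nhds x hr] with y hy
  rw [← hGF hy, hconst y hy, hGx]

lemma IsComposition.eqOn_ball_zero_of_eqOn_ball_pow_mul (hL : IsComposition L)
    (hF : ContDiff ℝ 1 F) (hF0 : ∀ y ∈ ball x r, dirac b L F y = 0) (hr : 0 < r) {q : ℝ}
    (hq : q ∈ Ioc 0 1) (n : ℕ) (hzero : ∀ y ∈ ball x (q ^ (n + 1) * r), F y = 0) :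
    ∀ y ∈ ball x (q * r), F y = 0 := by
  have hq0 : 0 < q := hq.1
  induction n with
  | zero => simpa using hzero
  | succ n ih =>
    have hle : q ^ n * r ≤ r := mul_le_of_le_one_left hr.le (pow_le_one₀ hq0.le hq.2)
    refine ih ?_
    rw [pow_succ', mul_assoc]
    refine hL.eqOn_ball_zero_of_eqOn_ball_sq_mul hF (fun y hy => hF0 y (ball_subset_ball hle hy))
      (by positivity) hq ?_
    rwa [← mul_assoc, ← pow_add, add_comm]

lemma IsComposition.eqOn_ball_zero_of_eventually_eq_zero (hL : IsComposition L)
    (hF : ContDiff ℝ 1 F) (hF0 : ∀ y ∈ ball x r, dirac b L F y = 0)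
    (h0 : ∀ᶠ y in 𝓝 x, F y = 0) : ∀ y ∈ ball x r, F y = 0 := by
  intro y hy
  have hr : 0 < r := pos_of_mem_ball hy
  obtain ⟨q, hyq, hq1⟩ := exists_between ((div_lt_one hr).2 hy)
  have hq0 : 0 < q := lt_of_le_of_lt (by positivity) hyq
  obtain ⟨δ, hδ, hδ0⟩ := eventually_nhds_iff_ball.1 h0
  obtain ⟨n, hn⟩ := exists_pow_lt_of_lt_one (div_pos hδ hr) hq1
  have hnδ : q ^ (n + 1) * r ≤ δ := by
    rw [← le_div_iff₀ hr]
    exact (pow_le_pow_of_le_one hq0.le hq1.le n.le_succ).trans hn.le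
  exact hL.eqOn_ball_zero_of_eqOn_ball_pow_mul hF hF0 hr ⟨hq0, hq1.le⟩ n
    (fun z hz => hδ0 z (ball_subset_ball hnδ hz)) y ((div_lt_iff₀ hr).1 hyq)

theorem IsMonogenicOn.eq_zero_of_eventually_eq_zero (hF : IsMonogenicOn b L F U)
    (hL : IsComposition L) (hU : IsOpen U) (hU' : IsPreconnected U) (hx : x ∈ U)
    (h0 : ∀ᶠ y in 𝓝 x, F y = 0) : ∀ y ∈ U, F y = 0 := by
  have hsub : U ⊆ {y | ∀ᶠ z in 𝓝 y, F z = 0} := by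
    refine hU'.subset_of_closure_inter_subset isOpen_setOfPred_eventually_nhds ⟨x, hx, h0⟩ ?_
    rintro y ⟨hy, hyU⟩
    obtain ⟨R, hR, hball⟩ := Metric.isOpen_iff.1 hU y hyU
    obtain ⟨z, hz, hyz⟩ := Metric.mem_closure_iff.1 hy (R / 3) (by positivity)
    have hsubset : ball z (2 * R / 3) ⊆ U :=
      (ball_subset_ball' (by rw [dist_comm]; linarith)).trans hball
    obtain ⟨G, hG, hGF, hG0⟩ :=
      (hF.mono hsubset).exists_contDiff_dirac_eq_zero (r := R / 3) (by positivity) (by linarith)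
    have hGz : ∀ᶠ w in 𝓝 z, G w = 0 := by
      filter_upwards [hz, ball_mem_nhds z (show 0 < R / 3 by positivity)] with w hw hwz
      rw [hGF hwz, hw]
    filter_upwards [isOpen_ball.mem_nhds hyz] with w hw
    rw [← hGF hw, hL.eqOn_ball_zero_of_eventually_eq_zero hG hG0 hGz w hw]
  exact fun y hy => (hsub hy).self_of_nhds

end MaximumPrinciple

section Indicator

open Set Topology

variable {E V : Type*} [NormedAddCommGroup E] [NormedSpace ℝ E] [NormedAddCommGroup V]
  [NormedSpace ℝ V] {F : E → V} {U S : Set E} {y : E}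

lemma hasFDerivAt_indicator {F' : E → E →L[ℝ] V} (hF : HasFDerivAt F (F' y) y)
    (h0 : y ∈ frontier S → F y = 0 ∧ F' y = 0) :
    HasFDerivAt (S.indicator F) (S.indicator F' y) y := by
  by_cases hy : y ∈ frontier S
  · obtain ⟨hFy, hF'y⟩ := h0 hy
    have hFo : F =o[𝓝 y] fun z => z - y := by
      simpa [hFy, hF'y] using hF.isLittleO
    have hle : S.indicator F =O[𝓝 y] F :=
      .of_bound' (.of_forall fun z => norm_indicator_le_norm_self F z)
    have hSy : S.indicator F y = 0 := indicator_apply_eq_zero.2 fun _ => hFy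
    have hSy' : S.indicator F' y = 0 := indicator_apply_eq_zero.2 fun _ => hF'y
    refine .of_isLittleO ?_
    simpa [hSy, hSy'] using hle.trans_isLittleO hFo
  · rw [← mem_compl_iff, compl_frontier_eq_union_interior] at hy
    rcases hy with hy | hy
    · rw [indicator_of_mem (interior_subset hy)]
      refine hF.congr_of_eventuallyEq ?_
      filter_upwards [mem_interior_iff_mem_nhds.1 hy] with z hz using indicator_of_mem hz F
    · rw [indicator_of_notMem (interior_subset hy)]
      refine (hasFDerivAt_const (0 : V) y).congr_of_eventuallyEq ?_
      filter_upwards [mem_interior_iff_mem_nhds.1 hy] with z hz using indicator_of_notMem hz F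

lemma fderiv_indicator (hF : DifferentiableAt ℝ F y)
    (h0 : y ∈ frontier S → F y = 0 ∧ fderiv ℝ F y = 0) :
    fderiv ℝ (S.indicator F) y = S.indicator (fderiv ℝ F) y :=
  (hasFDerivAt_indicator hF.hasFDerivAt h0).fderiv

lemma contDiffOn_one_indicator (hU : IsOpen U) (hF : ContDiffOn ℝ 1 F U)
    (h0 : ∀ y ∈ U ∩ frontier S, F y = 0 ∧ fderiv ℝ F y = 0) :
    ContDiffOn ℝ 1 (S.indicator F) U := by
  classical
  have hderiv (y) (hy : y ∈ U) : HasFDerivAt (S.indicator F) (S.indicator (fderiv ℝ F) y) y :=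
    hasFDerivAt_indicator (hF.differentiableOn one_ne_zero |>.differentiableAt
      (hU.mem_nhds hy)).hasFDerivAt fun hyS => h0 y ⟨hy, hyS⟩
  have hcont : ContinuousOn (S.indicator (fderiv ℝ F)) U := by
    rw [← piecewise_eq_indicator]
    exact .piecewise (fun y hy => (h0 y hy).2)
      ((hF.continuousOn_fderiv_of_isOpen hU le_rfl).mono inter_subset_left) continuousOn_const
  exact fun y hy => (contDiffAt_one_iff.2
    ⟨_, U, hU.mem_nhds hy, hcont, hderiv⟩).contDiffWithinAt

end Indicator

section UniqueContinuation

open Set Topology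

variable {ι E V W : Type*} [Fintype ι] [NormedAddCommGroup E] [InnerProductSpace ℝ E]
  [NormedAddCommGroup V] [InnerProductSpace ℝ V] [NormedAddCommGroup W] [InnerProductSpace ℝ W]
  {b : OrthonormalBasis ι ℝ E} {L : E →L[ℝ] V →L[ℝ] W} {F : E → V} {U S : Set E} {x n : E} {c : ℝ}

lemma IsMonogenicOn.indicator (hF : IsMonogenicOn b L F U) (hU : IsOpen U)
    (h0 : ∀ y ∈ U ∩ frontier S, F y = 0 ∧ fderiv ℝ F y = 0) :
    IsMonogenicOn b L (S.indicator F) U := by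
  refine ⟨contDiffOn_one_indicator hU hF.contDiffOn h0, fun y hy => ?_⟩
  have hFy := (hF.contDiffOn.differentiableOn one_ne_zero).differentiableAt (hU.mem_nhds hy)
  rw [dirac, fderiv_indicator hFy fun hyS => h0 y ⟨hy, hyS⟩]
  by_cases hyS : y ∈ S
  · rw [indicator_of_mem hyS]
    exact hF.dirac_eq_zero y hy
  · simp [indicator_of_notMem hyS]

lemma IsComposition.eq_zero_of_forall_inner_eq_zero (hL : IsComposition L) (hn : n ≠ 0)
    {A : E →L[ℝ] V} (hA : ∑ i, L (b i) (A (b i)) = 0) (hAn : ∀ v, inner ℝ n v = 0 → A v = 0) :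
    A = 0 := by
  have hrank (v : E) : ‖n‖ ^ 2 • A v = (inner ℝ n v : ℝ) • A n := by
    have h := hAn (‖n‖ ^ 2 • v - (inner ℝ n v : ℝ) • n) (by
      rw [inner_sub_right, inner_smul_right, inner_smul_right, real_inner_self_eq_norm_sq]
      ring)
    rwa [map_sub, map_smul, map_smul, sub_eq_zero] at h
  have hLn : L n (A n) = 0 := by
    calc L n (A n) = ∑ i, (inner ℝ (b i) n : ℝ) • L (b i) (A n) := by
          have h := congrArg (fun u => L u (A n)) (b.sum_repr' n)
          simpa only [map_sum, map_smul, sum_apply, smul_apply] using h.symm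
      _ = ‖n‖ ^ 2 • ∑ i, L (b i) (A (b i)) := by
          rw [Finset.smul_sum]
          refine Finset.sum_congr rfl fun i _ => ?_
          rw [← (L (b i)).map_smul, real_inner_comm, ← hrank, (L (b i)).map_smul]
      _ = 0 := by rw [hA, smul_zero]
  have hA0 : A n = 0 := by
    rw [← norm_eq_zero] at hLn ⊢
    rw [hL] at hLn
    exact (mul_eq_zero.1 hLn).resolve_left (norm_ne_zero_iff.2 hn)
  ext v
  have h := hrank v
  rw [hA0, smul_zero] at h
  exact (smul_eq_zero.1 h).resolve_left (by simpa using hn)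

lemma IsMonogenicOn.fderiv_eq_zero_of_hyperplane (hF : IsMonogenicOn b L F U)
    (hL : IsComposition L) (hU : IsOpen U) (hn : n ≠ 0)
    (h0 : ∀ y ∈ U, inner ℝ n y = c → F y = 0) (hx : x ∈ U) (hxc : inner ℝ n x = c) :
    fderiv ℝ F x = 0 := by
  refine hL.eq_zero_of_forall_inner_eq_zero hn (hF.dirac_eq_zero x hx) fun v hv => ?_
  have hFx := (hF.contDiffOn.differentiableOn one_ne_zero).differentiableAt (hU.mem_nhds hx)
  refine (hFx.hasFDerivAt.hasLineDerivAt v).unique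
    ((hasDerivAt_const (0 : ℝ) (0 : V)).congr_of_eventuallyEq ?_)
  have hline : ContinuousAt (fun t : ℝ => x + t • v) 0 := by fun_prop
  filter_upwards [hline.eventually (hU.mem_nhds (by simpa using hx))] with t ht
  exact h0 _ ht (by simp [inner_add_right, inner_smul_right, hv, hxc])

theorem IsMonogenicOn.eq_zero_of_eq_zero_on_hyperplane (hF : IsMonogenicOn b L F U)
    (hL : IsComposition L) (hU : IsOpen U) (hU' : IsPreconnected U) (hn : n ≠ 0)
    (h0 : ∀ y ∈ U, inner ℝ n y = c → F y = 0) (hx : x ∈ U) (hxc : inner ℝ n x = c) :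
    ∀ y ∈ U, F y = 0 := by
  let S := {y : E | c < inner ℝ n y}
  have hS : frontier S ⊆ {y | c = inner ℝ n y} :=
    frontier_lt_subset_eq continuous_const (by fun_prop)
  have hG : IsMonogenicOn b L (S.indicator F) U := hF.indicator hU fun y ⟨hy, hyS⟩ =>
    ⟨h0 y hy (hS hyS).symm, hF.fderiv_eq_zero_of_hyperplane hL hU hn h0 hy (hS hyS).symm⟩
  have hpush (s : ℝ) : inner ℝ n (x + s • n) = c + s * ‖n‖ ^ 2 := by
    rw [inner_add_right, inner_smul_right, hxc, real_inner_self_eq_norm_sq]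
  have hn2 : 0 < ‖n‖ ^ 2 := by positivity
  have hline : ContinuousAt (fun s : ℝ => x + s • n) 0 := by fun_prop
  have hmem : ∀ᶠ s : ℝ in 𝓝 0, x + s • n ∈ U :=
    hline.eventually (hU.mem_nhds (by simpa using hx))
  obtain ⟨s, hsU, hs⟩ : ∃ s : ℝ, x + s • n ∈ U ∧ s < 0 :=
    ((hmem.filter_mono (nhdsWithin_le_nhds (s := Iio 0))).and self_mem_nhdsWithin).exists
  obtain ⟨t, htU, ht⟩ : ∃ t : ℝ, x + t • n ∈ U ∧ 0 < t :=
    ((hmem.filter_mono (nhdsWithin_le_nhds (s := Ioi 0))).and self_mem_nhdsWithin).exists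
  have hbelow : ∀ᶠ y in 𝓝 (x + s • n), inner ℝ n y < c :=
    (isOpen_lt (by fun_prop) continuous_const).mem_nhds (by
      rw [mem_ofPred_eq, hpush]
      linarith [mul_neg_of_neg_of_pos hs hn2])
  have habove : ∀ᶠ y in 𝓝 (x + t • n), c < inner ℝ n y :=
    (isOpen_lt continuous_const (by fun_prop)).mem_nhds (by
      rw [mem_ofPred_eq, hpush]
      linarith [mul_pos ht hn2])
  have hG0 := hG.eq_zero_of_eventually_eq_zero hL hU hU' hsU
    (hbelow.mono fun y hy => indicator_of_notMem (s := S) hy.not_gt F)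
  refine hF.eq_zero_of_eventually_eq_zero hL hU hU' htU ?_
  filter_upwards [habove, hU.mem_nhds htU] with y hy hyU
  rw [← indicator_of_mem (s := S) hy F, hG0 y hyU]

end UniqueContinuation

namespace Octonion

lemma mul_apply (x y : Octonion) (k : Fin 8) :
    (x * y) k = ∑ i : Fin 8, ∑ j : Fin 8, (structureConst i j k : ℝ) * (x i * y j) := rfl

lemma mul_eq (x y : Octonion) : x * y = !₂[
    x 0 * y 0 - x 1 * y 1 - x 2 * y 2 - x 3 * y 3 - x 4 * y 4 - x 5 * y 5 - x 6 * y 6 - x 7 * y 7,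
    x 0 * y 1 + x 1 * y 0 + x 2 * y 3 - x 3 * y 2 + x 4 * y 5 - x 5 * y 4 - x 6 * y 7 + x 7 * y 6,
    x 0 * y 2 - x 1 * y 3 + x 2 * y 0 + x 3 * y 1 + x 4 * y 6 + x 5 * y 7 - x 6 * y 4 - x 7 * y 5,
    x 0 * y 3 + x 1 * y 2 - x 2 * y 1 + x 3 * y 0 + x 4 * y 7 - x 5 * y 6 + x 6 * y 5 - x 7 * y 4,
    x 0 * y 4 - x 1 * y 5 - x 2 * y 6 - x 3 * y 7 + x 4 * y 0 + x 5 * y 1 + x 6 * y 2 + x 7 * y 3,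
    x 0 * y 5 + x 1 * y 4 - x 2 * y 7 + x 3 * y 6 - x 4 * y 1 + x 5 * y 0 - x 6 * y 3 + x 7 * y 2,
    x 0 * y 6 + x 1 * y 7 + x 2 * y 4 - x 3 * y 5 - x 4 * y 2 + x 5 * y 3 + x 6 * y 0 - x 7 * y 1,
    x 0 * y 7 - x 1 * y 6 + x 2 * y 5 + x 3 * y 4 - x 4 * y 3 - x 5 * y 2 + x 6 * y 1 + x 7 * y 0
    ] := by
  ext k
  fin_cases k <;> simp [mul_apply, Fin.sum_univ_eight, structureConst, eps, triples] <;> ring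

lemma norm_mul (x y : Octonion) : ‖x * y‖ = ‖x‖ * ‖y‖ := by
  refine (sq_eq_sq₀ (norm_nonneg _) (by positivity)).1 ?_
  simp only [mul_pow, EuclideanSpace.real_norm_sq_eq, Fin.sum_univ_eight, mul_eq,
    Matrix.cons_val_zero, Matrix.cons_val_one, Matrix.cons_val]
  ring

/-- Octonionic multiplication as a continuous bilinear map. -/
noncomputable def mulL : Octonion →L[ℝ] Octonion →L[ℝ] Octonion :=
  (LinearMap.mk₂ ℝ (· * ·)
    (fun x x' y => by ext k; simp [mul_apply, add_mul, mul_add, Finset.sum_add_distrib])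
    (fun c x y => by ext k; simp [mul_apply, Finset.mul_sum, mul_assoc, mul_left_comm c])
    (fun x y y' => by ext k; simp [mul_apply, mul_add, Finset.sum_add_distrib])
    (fun c x y => by ext k; simp [mul_apply, Finset.mul_sum, mul_left_comm c])).mkContinuous₂ 1
    fun x y => by simp [norm_mul]

@[simp] lemma mulL_apply (x y : Octonion) : mulL x y = x * y := rfl

variable {p : Fin 7} {Ω : Set Octonion} {f : Octonion → Octonion} {ω x : Octonion}

/-- The orthonormal system `e_0, …, e_p, ω` spanning a slice. -/
noncomputable def sliceBasis (p : Fin 7) (ω : Octonion) : Fin ((p : ℕ) + 2) → Octonion :=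
  Fin.snoc (α := fun _ => Octonion) (fun i : Fin ((p : ℕ) + 1) => e (idx p i)) ω

@[simp] lemma sliceBasis_castSucc (p : Fin 7) (ω : Octonion) (i : Fin ((p : ℕ) + 1)) :
    sliceBasis p ω i.castSucc = e (idx p i) := by
  simp [sliceBasis]

@[simp] lemma sliceBasis_last (p : Fin 7) (ω : Octonion) :
    sliceBasis p ω (Fin.last _) = ω := by
  simp [sliceBasis]

lemma idx_injective (p : Fin 7) : Function.Injective (idx p) := Fin.castLE_injective (by omega)

lemma idx_le (p : Fin 7) (i : Fin ((p : ℕ) + 1)) : (idx p i : ℕ) ≤ p :=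
  Nat.lt_succ_iff.1 i.2

lemma orthonormal_sliceBasis (hω : ω ∈ sphere p) : Orthonormal ℝ (sliceBasis p ω) := by
  rw [orthonormal_iff_ite]
  intro i j
  refine Fin.lastCases ?_ (fun i => ?_) i <;> refine Fin.lastCases ?_ (fun j => ?_) j
  · simp [hω.2]
  · simp [e, EuclideanSpace.inner_single_right, hω.1 _ (idx_le p j), (Fin.castSucc_ne_last j).symm]
  · simp [e, EuclideanSpace.inner_single_left, hω.1 _ (idx_le p i), Fin.castSucc_ne_last i]
  · simp [e, EuclideanSpace.inner_single_left, (idx_injective p).eq_iff]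

/-- The isometry of `ℝ^{p+2}` onto the slice of `ω` sending the standard basis to
`e_0, …, e_p, ω`. -/
noncomputable def sliceIsometry (hω : ω ∈ sphere p) :
    EuclideanSpace ℝ (Fin ((p : ℕ) + 2)) →ₗᵢ[ℝ] Octonion :=
  ((EuclideanSpace.basisFun _ ℝ).toBasis.constr ℝ (sliceBasis p ω)).isometryOfOrthonormal
    (v := (EuclideanSpace.basisFun _ ℝ).toBasis)
    (by simp)
    (by simpa [Function.comp_def] using orthonormal_sliceBasis hω)

lemma sliceIsometry_basisFun (hω : ω ∈ sphere p) (i : Fin ((p : ℕ) + 2)) :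
    sliceIsometry hω (EuclideanSpace.basisFun _ ℝ i) = sliceBasis p ω i := by
  rw [← OrthonormalBasis.coe_toBasis]
  exact Module.Basis.constr_basis _ ℝ _ i

/-- The symbol of the slice Cauchy–Riemann operator `sliceD p ω`. -/
noncomputable def sliceSymbol (hω : ω ∈ sphere p) :
    EuclideanSpace ℝ (Fin ((p : ℕ) + 2)) →L[ℝ] Octonion →L[ℝ] Octonion :=
  mulL ∘L (sliceIsometry hω).toContinuousLinearMap

lemma isComposition_sliceSymbol (hω : ω ∈ sphere p) : IsComposition (sliceSymbol hω) :=
  fun v x => by simp [sliceSymbol, norm_mul]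

lemma dirac_sliceSymbol (hω : ω ∈ sphere p) (F : EuclideanSpace ℝ (Fin ((p : ℕ) + 2)) → Octonion)
    (v : EuclideanSpace ℝ (Fin ((p : ℕ) + 2))) :
    dirac (EuclideanSpace.basisFun _ ℝ) (sliceSymbol hω) F v = sliceD p ω F v := by
  have hsymbol (i : Fin ((p : ℕ) + 2)) (y : Octonion) :
      sliceSymbol hω (EuclideanSpace.basisFun _ ℝ i) y = sliceBasis p ω i * y := by
    rw [← sliceIsometry_basisFun hω]
    rfl
  simp only [dirac, hsymbol]
  simp only [Fin.sum_univ_castSucc (n := (p : ℕ) + 1), sliceD, sliceBasis_castSucc,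
    sliceBasis_last, EuclideanSpace.basisFun_apply]

lemma IsGSM.isMonogenicOn_restrict (hf : IsGSM p Ω f) (hω : ω ∈ sphere p) :
    IsMonogenicOn (EuclideanSpace.basisFun _ ℝ) (sliceSymbol hω) (restrict p ω f)
      (slice p ω Ω) :=
  ⟨(hf ω hω).1, fun v hv => (dirac_sliceSymbol hω _ v).trans ((hf ω hω).2 v hv)⟩

lemma continuous_slicePoint (p : Fin 7) (ω : Octonion) : Continuous (slicePoint p ω) := by
  unfold slicePoint
  fun_prop

lemma sum_smul_e_apply (p : Fin 7) (c : Fin ((p : ℕ) + 1) → ℝ) (k : Fin 8) :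
    (∑ i, c i • e (idx p i)) k = if h : (k : ℕ) < (p : ℕ) + 1 then c ⟨k, h⟩ else 0 := by
  have hterm (i) : (c i • e (idx p i)) k = if (k : ℕ) = i then c i else 0 := by
    simp [e, Fin.ext_iff, idx]
  simp only [WithLp.ofLp_sum, Finset.sum_apply, hterm]
  split_ifs with h
  · rw [Finset.sum_eq_single ⟨k, h⟩ (fun i _ hi => if_neg fun hk => hi (Fin.ext hk.symm))
      (by simp)]
    simp
  · exact Finset.sum_eq_zero fun i _ => if_neg fun hk => h (by rw [hk]; exact i.2)

lemma e_last_mem_sphere (p : Fin 7) : e 7 ∈ sphere p := by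
  refine ⟨fun i hi => ?_, by simp [e]⟩
  have : i ≠ 7 := by
    rintro rfl
    exact (hi.trans_lt p.2).false
  simp [e, this]

/-- The coordinates, in any slice, of the point with the paravector part of `x` and last
coordinate `r`. -/
noncomputable def sliceCoords (p : Fin 7) (x : Octonion) (r : ℝ) :
    EuclideanSpace ℝ (Fin ((p : ℕ) + 2)) :=
  WithLp.toLp 2 (Fin.snoc (α := fun _ => ℝ) (fun i : Fin ((p : ℕ) + 1) => x (idx p i)) r)

@[simp] lemma sliceCoords_castSucc (p : Fin 7) (x : Octonion) (r : ℝ) (i : Fin ((p : ℕ) + 1)) :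
    sliceCoords p x r i.castSucc = x (idx p i) := by
  simp [sliceCoords]

@[simp] lemma sliceCoords_last (p : Fin 7) (x : Octonion) (r : ℝ) :
    sliceCoords p x r (Fin.last _) = r := by
  simp [sliceCoords]

lemma slicePoint_sliceCoords_apply (p : Fin 7) (ω x : Octonion) (r : ℝ) (k : Fin 8) :
    slicePoint p ω (sliceCoords p x r) k = (if (k : ℕ) ≤ p then x k else 0) + r * ω k := by
  simp only [slicePoint, PiLp.add_apply, PiLp.smul_apply, smul_eq_mul, sum_smul_e_apply,
    sliceCoords_castSucc, sliceCoords_last, Nat.lt_succ_iff]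
  rfl

lemma slicePoint_sliceCoords_of_mem_paravectors (hx : x ∈ paravectors p) (ω : Octonion) :
    slicePoint p ω (sliceCoords p x 0) = x := by
  ext k
  rw [slicePoint_sliceCoords_apply]
  split_ifs with hk
  · simp
  · simp [hx k (not_le.1 hk)]

lemma slicePoint_eq_of_last_eq_zero {v : EuclideanSpace ℝ (Fin ((p : ℕ) + 2))}
    (hv : v (Fin.last _) = 0) (ω ω' : Octonion) : slicePoint p ω v = slicePoint p ω' v := by
  simp [slicePoint, hv]

lemma exists_slicePoint_eq (p : Fin 7) (x : Octonion) :
    ∃ ω ∈ sphere p, ∃ v, slicePoint p ω v = x := by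
  let y : Octonion := WithLp.toLp 2 fun k => if (k : ℕ) ≤ p then 0 else x k
  by_cases hx : x ∈ paravectors p
  · exact ⟨e 7, e_last_mem_sphere p, _, slicePoint_sliceCoords_of_mem_paravectors hx _⟩
  · have hy : ‖y‖ ≠ 0 := fun hy => hx fun k hk => by
      simpa [y, hk.not_ge] using congrFun (congrArg WithLp.ofLp (norm_eq_zero.1 hy)) k
    refine ⟨‖y‖⁻¹ • y, ⟨fun i hi => by simp [y, hi], ?_⟩, sliceCoords p x ‖y‖, ?_⟩
    · rw [norm_smul, norm_inv, norm_norm, inv_mul_cancel₀ hy]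
    · ext k
      rw [slicePoint_sliceCoords_apply, PiLp.smul_apply, smul_eq_mul, mul_inv_cancel_left₀ hy]
      by_cases hk : (k : ℕ) ≤ p <;> simp [y, hk]

lemma IsGSM.restrict_eq_of_isLocalMaxOn (hf : IsGSM p Ω f) (hΩ : IsSliceDomain p Ω)
    (hω : ω ∈ sphere p) {v : EuclideanSpace ℝ (Fin ((p : ℕ) + 2))} (hv : v ∈ slice p ω Ω)
    (hmax : IsLocalMaxOn (fun x => ‖f x‖) Ω (slicePoint p ω v)) :
    ∀ w ∈ slice p ω Ω, restrict p ω f w = restrict p ω f v := by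
  have hL := isComposition_sliceSymbol hω
  have hU := hΩ.slice_isOpen ω hω
  have hF := hf.isMonogenicOn_restrict hω
  have hmax' : IsLocalMax (fun w => ‖restrict p ω f w‖) v :=
    (continuous_slicePoint p ω).continuousAt.eventually (hmax.isLocalMax (hΩ.isOpen.mem_nhds hv))
  have hconst := hF.eventually_eq_of_isLocalMax_norm hL (hU.mem_nhds hv) hmax'
  intro w hw
  exact sub_eq_zero.1 <| (hF.sub_const _).eq_zero_of_eventually_eq_zero hL hU
    (hΩ.slice_isConnected ω hω).isPreconnected hv (hconst.mono fun _ => sub_eq_zero.2) w hw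

lemma IsGSM.restrict_eq_const_of_restrict_eq_const (hf : IsGSM p Ω f) (hΩ : IsSliceDomain p Ω)
    {ω' c : Octonion} (hω' : ω' ∈ sphere p) (hc : ∀ v ∈ slice p ω Ω, restrict p ω f v = c) :
    ∀ v ∈ slice p ω' Ω, restrict p ω' f v = c := by
  obtain ⟨b, hbΩ, hb⟩ := hΩ.inter_nonempty
  have hbslice : sliceCoords p b 0 ∈ slice p ω' Ω := by
    rwa [slice, Set.mem_ofPred_eq, slicePoint_sliceCoords_of_mem_paravectors hb]
  let n : EuclideanSpace ℝ (Fin ((p : ℕ) + 2)) := EuclideanSpace.single (Fin.last _) 1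
  have hn (v : EuclideanSpace ℝ (Fin ((p : ℕ) + 2))) : inner ℝ n v = v (Fin.last _) := by
    simp [n, EuclideanSpace.inner_single_left]
  have h0 (v) (hv : v ∈ slice p ω' Ω) (hv0 : inner ℝ n v = 0) : restrict p ω' f v - c = 0 := by
    have hω := slicePoint_eq_of_last_eq_zero ((hn v).symm.trans hv0) ω' ω
    rw [slice, Set.mem_ofPred_eq, hω] at hv
    rw [restrict, hω, sub_eq_zero]
    exact hc v hv
  have hF := (hf.isMonogenicOn_restrict hω').sub_const c
  intro v hv
  exact sub_eq_zero.1 <| hF.eq_zero_of_eq_zero_on_hyperplane (isComposition_sliceSymbol hω')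
    (hΩ.slice_isOpen ω' hω') (hΩ.slice_isConnected ω' hω').isPreconnected (by simp [n]) h0
    hbslice (by simp [hn]) v hv

end Octonion

theorem mainTheorem8 (p : Fin 7) (Ω : Set Octonion) (f : Octonion → Octonion)
    (hΩ : Octonion.IsSliceDomain p Ω) (hf : Octonion.IsGSM p Ω f)
    (hmax : ∃ a ∈ Ω, IsLocalMaxOn (fun x => ‖f x‖) Ω a) :
    ∃ c : Octonion, ∀ x ∈ Ω, f x = c := by
  obtain ⟨a, ha, hmax⟩ := hmax
  obtain ⟨ω, hω, v, rfl⟩ := Octonion.exists_slicePoint_eq p a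
  have hslice := hf.restrict_eq_of_isLocalMaxOn hΩ hω ha hmax
  refine ⟨f (Octonion.slicePoint p ω v), fun x hx => ?_⟩
  obtain ⟨ω', hω', v', rfl⟩ := Octonion.exists_slicePoint_eq p x
  exact hf.restrict_eq_const_of_restrict_eq_const hΩ hω' hslice v' hx
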